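/- Let $(R,\mathfrak m)$ be a Cohen–Macaulay (Noetherian) local ring of Krull dimension $2$ with infinite residue field, let $I$ be an $\mathfrak m$-primary ideal of $R$, and let $x\in I$ be a superficial element for $I$, that is, there is an integer $c\ge 1$ with $(I^{n+1}:x)\cap I^{c}=I^{n}$ for all $n\ge c$. Let $H_I(n)=\lambda(R/I^n)$ for $n\in\mathbb Z$ (with $I^n=R$ for $n\le 0$; $\lambda$ denotes length), let $P_I\in\mathbb Q[X]$ be the Hilbert–Samuel polynomial of $I$, i.e. the polynomial with $P_I(n)=H_I(n)$ for all $n\gg 0$, and let $$\operatorname{n}(I)=\min\{n\in\mathbb Z : P_I(t)=H_I(t)\text{ for all integers } t>n\}$$ be the postulation number of $I$. For an ideal $K$ let $\widetilde{K}=\bigcup_{n\ge 1}(K^{n+1}:K^n)$ be its Ratliff–Rush closure, and let $$\rho(I)=\min\{i\ge 1 : \widetilde{I^n}=I^n\text{ for all } n\ge i\}$$ be the stability index of the Ratliff–Rush filtration of $I$. A reduction of $I$ is an ideal $J\subseteq I$ with $JI^n=I^{n+1}$ for some $n\ge 0$; the least such $n$ is denoted $\operatorname{rd}_J(I)$, and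 the reduction number of $I$ is $\operatorname{rd}(I)=\min_J \operatorname{rd}_J(I)$, where $J$ runs over the reductions of $I$ that are minimal with respect to inclusion. If $\operatorname{n}(I)\neq\rho(I)-1$, then $\operatorname{rd}(I)\ge \operatorname{n}(I)+2$. -/

import Mathlib

namespace RatliffRush

open IsLocalRing Polynomial

variable {R : Type*} [CommRing R]

/-- A Noetherian local ring is Cohen-Macaulay if its depth equals its Krull dimension, i.e. if its
maximal ideal contains a regular sequence whose length is the dimension (no regular sequence in
the maximal ideal can be longer). -/
structure IsCohenMacaulayLocal (R : Type*) [CommRing R] [IsLocalRing R] : Prop where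
  noetherian : IsNoetherianRing R
  exists_regular : ∃ rs : List R, (∀ r ∈ rs, r ∈ maximalIdeal R) ∧
    RingTheory.Sequence.IsRegular R rs ∧ (rs.length : WithBot ℕ∞) = ringKrullDim R

/-- `I` is `𝔪`-primary: a primary ideal whose radical is the maximal ideal. -/
def IsMaxPrimary [IsLocalRing R] (I : Ideal R) : Prop :=
  I.IsPrimary ∧ I.radical = maximalIdeal R

/-- `x ∈ I` is superficial for `I`: there is a positive integer `c` such that
`(I ^ (n + 1) : x) ∩ I ^ c = I ^ n` for all `n ≥ c`. -/
def IsSuperficial (I : Ideal R) (x : R) : Prop :=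
  x ∈ I ∧ ∃ c : ℕ, 0 < c ∧ ∀ n : ℕ, c ≤ n → (I ^ (n + 1)).colon {x} ⊓ I ^ c = I ^ n

/-- The Ratliff-Rush closure `⋃_{n ≥ 1} (I ^ (n + 1) : I ^ n)`; the union is increasing in `n`, so
it is the supremum of these ideals. -/
def closure (I : Ideal R) : Ideal R :=
  ⨆ (n : ℕ) (_ : 1 ≤ n), (I ^ (n + 1)).colon ((I ^ n : Ideal R) : Set R)

/-- The stability index `ρ(I)`: the least `i ≥ 1` such that `I ^ n` is Ratliff-Rush closed for all
`n ≥ i`. -/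
noncomputable def stabilityIndex (I : Ideal R) : ℕ :=
  sInf {i : ℕ | 1 ≤ i ∧ ∀ n : ℕ, i ≤ n → closure (I ^ n) = I ^ n}

/-- The Hilbert-Samuel function `H_I(n) = λ(R / I ^ n)` for `n : ℤ`, where `I ^ n = R` for `n ≤ 0`
(so that `H_I(n) = 0` there). -/
noncomputable def hilbertFun (I : Ideal R) (n : ℤ) : ℕ :=
  (Module.length R (R ⧸ I ^ n.toNat)).toNat

open Classical in
/-- The Hilbert-Samuel polynomial `P_I`: the (unique) polynomial with rational coefficients such
that `P_I(n) = H_I(n)` for all large `n`; it exists for `𝔪`-primary ideals of Noetherian local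
rings, and the value is `0` if there is none. -/
noncomputable def hilbertPoly (I : Ideal R) : ℚ[X] :=
  if h : ∃ P : ℚ[X], ∃ N : ℤ, ∀ n : ℤ, N ≤ n → P.eval (n : ℚ) = (hilbertFun I n : ℚ)
  then h.choose else 0

/-- The postulation number `n(I)`: the least integer `n` with `P_I(t) = H_I(t)` for all integers
`t > n`. -/
noncomputable def postulationNumber (I : Ideal R) : ℤ :=
  sInf {n : ℤ | ∀ t : ℤ, n < t → (hilbertPoly I).eval (t : ℚ) = (hilbertFun I t : ℚ)}

/-- `J` is a reduction of `I`. -/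
def IsReduction (I J : Ideal R) : Prop :=
  J ≤ I ∧ ∃ n : ℕ, J * I ^ n = I ^ (n + 1)

/-- `J` is a minimal reduction of `I`: minimal under inclusion among the reductions of `I`. -/
def IsMinimalReduction (I J : Ideal R) : Prop :=
  Minimal (IsReduction I) J

/-- The reduction number `rd_J(I)` of `I` with respect to a reduction `J`: the least `n ≥ 0` with
`J I ^ n = I ^ (n + 1)`. -/
noncomputable def reductionNumberWrt (I J : Ideal R) : ℕ :=
  sInf {n : ℕ | J * I ^ n = I ^ (n + 1)}

/-- The reduction number `rd(I)`: the minimum of `rd_J(I)` over all minimal reductions `J` of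
`I`. -/
noncomputable def reductionNumber (I : Ideal R) : ℕ :=
  sInf {r : ℕ | ∃ J : Ideal R, IsMinimalReduction I J ∧ reductionNumberWrt I J = r}

end RatliffRush

/-!
Let `a, b` generate a reduction of `I` with `(a, b) I ^ r = I ^ (r + 1)`, where `a` is superficial
and `b` is regular modulo `a`. Multiplication by `a` gives
`λ(R / I ^ (n + 1)) = λ(R / (I ^ (n + 1) : a)) + λ(R / (I ^ (n + 1) + (a)))`, and the last summand
is linear in `n` as soon as `n + 1 ≥ r`. Since the colon ideal is `I ^ n` for large `n`, it follows
that `λ(R / (I ^ (n + 1) : a)) = P_I(n)` whenever `n ≥ n(I)` and `n + 1 ≥ r`. If `r ≤ n(I) + 1`,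
then `n(I)` is therefore the last `n` at which `(I ^ (n + 1) : a) ≠ I ^ n`, and these equalities of
colon ideals detect Ratliff-Rush closedness, so that `ρ(I) = n(I) + 1`.

Every reduction contains such a pair. All of these pairs have the same colength, the multiplicity of
`I`, so none of the ideals they generate contains another one properly: they are exactly the minimal
reductions.
-/

namespace RatliffRush

open Filter IsLocalRing Polynomial
open scoped TensorProduct

section Avoidance

theorem exists_mem_forall_notMem {R M : Type*} [CommRing R] [IsLocalRing R]
    [Infinite (ResidueField R)] [AddCommGroup M] [Module R M] {N : Submodule R M} (hN : N.FG)
    {F : Set (Submodule R M)} (hF : F.Finite) (hNF : ∀ K ∈ F, ¬ N ≤ K) :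
    ∃ v ∈ N, ∀ K ∈ F, v ∉ K := by
  classical
  have : Module.Finite R N := Module.Finite.iff_fg.2 hN
  let k := ResidueField R
  let π (K : Submodule R M) : k ⊗[R] N →ₗ[k] k ⊗[R] (N ⧸ K.submoduleOf N) :=
    (K.submoduleOf N).mkQ.baseChange k
  have htop : ⊤ ∉ hF.toFinset.image fun K => LinearMap.ker (π K) := by
    simp only [Finset.mem_image, Set.Finite.mem_toFinset, not_exists, not_and]
    intro K hK hker
    have hsurj : Function.Surjective (π K) :=
      LinearMap.lTensor_surjective k (Submodule.mkQ_surjective _)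
    have hsub : Subsingleton (k ⊗[R] (N ⧸ K.submoduleOf N)) := by
      refine subsingleton_of_forall_eq 0 fun y => ?_
      obtain ⟨v, rfl⟩ := hsurj y
      exact LinearMap.mem_ker.1 (hker ▸ Submodule.mem_top)
    rw [subsingleton_tensorProduct, Submodule.Quotient.subsingleton_iff,
      Submodule.submoduleOf_eq_top] at hsub
    exact hNF K hK hsub
  obtain ⟨v, hv⟩ :=
    (Set.ne_univ_iff_exists_notMem _).1 (Subspace.biUnion_ne_univ_of_top_notMem htop)
  obtain ⟨n, rfl⟩ := TensorProduct.mk_surjective R N k residue_surjective v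
  refine ⟨n, n.2, fun K hK hnK => hv ?_⟩
  have hn : (K.submoduleOf N).mkQ n = 0 := (Submodule.Quotient.mk_eq_zero _).2 hnK
  simp only [Finset.mem_image, Set.Finite.mem_toFinset, Set.mem_iUnion]
  exact ⟨_, ⟨K, hK, rfl⟩, by simp [π, hn]⟩

end Avoidance

section ReesAlgebra

variable {R : Type*} [CommRing R] {I : Ideal R}

/-- The degree `n` component of an ideal `P` of the Rees algebra `R[I t]`, as an ideal of `R`: it
consists of the `z` with `z t ^ n ∈ P`. -/
noncomputable def reesComponent (P : Ideal (reesAlgebra I)) (n : ℕ) : Ideal R :=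
  ((P.restrictScalars R).map (reesAlgebra I).val.toLinearMap).comap (monomial n)

theorem mem_reesComponent {P : Ideal (reesAlgebra I)} {n : ℕ} {z : R} :
    z ∈ reesComponent P n ↔
      ∃ hz : z ∈ I ^ n, (⟨monomial n z, reesAlgebra.monomial_mem.2 hz⟩ : reesAlgebra I) ∈ P := by
  constructor
  · rintro ⟨⟨f, hf⟩, hfP, rfl : f = monomial n z⟩
    exact ⟨reesAlgebra.monomial_mem.1 hf, hfP⟩
  · rintro ⟨_, hzP⟩
    exact ⟨_, hzP, rfl⟩

theorem reesComponent_mono {P Q : Ideal (reesAlgebra I)} (hPQ : P ≤ Q) (n : ℕ) :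
    reesComponent P n ≤ reesComponent Q n :=
  Submodule.comap_mono (Submodule.map_mono hPQ)

theorem reesComponent_top (n : ℕ) : reesComponent (⊤ : Ideal (reesAlgebra I)) n = I ^ n := by
  ext z
  simp only [mem_reesComponent, Submodule.mem_top, exists_prop, and_true]

theorem reesComponent_mul_le (P Q : Ideal (reesAlgebra I)) (m n : ℕ) :
    reesComponent P m * reesComponent Q n ≤ reesComponent (P * Q) (m + n) := by
  refine Ideal.mul_le.2 fun y hy z hz => ?_
  obtain ⟨hyI, hyP⟩ := mem_reesComponent.1 hy
  obtain ⟨hzI, hzQ⟩ := mem_reesComponent.1 hz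
  refine mem_reesComponent.2 ⟨pow_add I m n ▸ Ideal.mul_mem_mul hyI hzI, ?_⟩
  convert Ideal.mul_mem_mul hyP hzQ
  exact (monomial_mul_monomial m n y z).symm

theorem reesComponent_one_pow_le (P : Ideal (reesAlgebra I)) (k : ℕ) :
    reesComponent P 1 ^ k ≤ reesComponent (P ^ k) k := by
  induction k with
  | zero => rw [pow_zero, pow_zero, Ideal.one_eq_top, Ideal.one_eq_top, reesComponent_top, pow_zero,
      Ideal.one_eq_top]
  | succ k ih =>
    rw [pow_succ, pow_succ]
    exact (Ideal.mul_mono_left ih).trans (reesComponent_mul_le _ _ _ _)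

/-- The quotient of the Rees algebra by the extension of `I` is the associated graded ring of `I`;
this is the vanishing criterion for its homogeneous elements. -/
theorem reesComponent_map_algebraMap (I : Ideal R) (n : ℕ) :
    reesComponent (I.map (algebraMap R (reesAlgebra I))) n = I ^ (n + 1) := by
  set E := I.map (algebraMap R (reesAlgebra I))
  have coeff_mem : ∀ f ∈ E, ∀ i, (f : R[X]).coeff i ∈ I ^ (i + 1) := by
    intro f hf
    induction hf using Submodule.span_induction with
    | mem f hf =>
      obtain ⟨y, hy, rfl⟩ := hf
      rintro (_ | i)
      · simpa using hy
      · simp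
    | zero => simp
    | add f g _ _ hf hg => exact fun i => by simpa using add_mem (hf i) (hg i)
    | smul f g _ hg =>
      intro i
      rw [smul_eq_mul, MulMemClass.coe_mul, coeff_mul]
      refine sum_mem fun p hp => ?_
      rw [← Finset.HasAntidiagonal.mem_antidiagonal.1 hp, add_assoc, pow_add]
      exact Ideal.mul_mem_mul (f.2 p.1) (hg p.2)
  apply le_antisymm
  · intro z hz
    obtain ⟨hzI, hzE⟩ := mem_reesComponent.1 hz
    simpa using coeff_mem _ hzE n
  · have hI : I ≤ reesComponent E 0 := fun y hy =>
      mem_reesComponent.2 ⟨by simp, Ideal.mem_map_of_mem (algebraMap R (reesAlgebra I)) hy⟩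
    calc I ^ (n + 1) = I * I ^ n := pow_succ' I n
      _ ≤ reesComponent E 0 * reesComponent ⊤ n := Ideal.mul_mono hI (reesComponent_top n).ge
      _ ≤ reesComponent (E * ⊤) (0 + n) := reesComponent_mul_le _ _ _ _
      _ = reesComponent E n := by rw [Ideal.mul_top, zero_add]

theorem mem_reesComponent_of_mul_mem {Q : Ideal (reesAlgebra I)} (hQ : Q.IsPrimary) {b z : R}
    {n : ℕ} (hb : b ∈ I) (hbQ : b ∉ reesComponent Q.radical 1) (hz : z ∈ I ^ n)
    (hzb : z * b ∈ reesComponent Q (n + 1)) : z ∈ reesComponent Q n := by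
  obtain ⟨_, hzbQ⟩ := mem_reesComponent.1 hzb
  have hb' : b ∈ I ^ 1 := by rwa [pow_one]
  let zt : reesAlgebra I := ⟨monomial n z, reesAlgebra.monomial_mem.2 hz⟩
  let bt : reesAlgebra I := ⟨monomial 1 b, reesAlgebra.monomial_mem.2 hb'⟩
  have hmul : zt * bt ∈ Q := by
    convert hzbQ
    exact monomial_mul_monomial n 1 z b
  exact mem_reesComponent.2 ⟨hz, ((Ideal.isPrimary_iff.1 hQ).2 hmul).resolve_right
    fun h => hbQ (mem_reesComponent.2 ⟨hb', h⟩)⟩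

end ReesAlgebra

section Reductions

variable {R : Type*} [CommRing R] {I J : Ideal R}

theorem mul_pow_eq_of_le {s n : ℕ} (h : J * I ^ s = I ^ (s + 1)) (hsn : s ≤ n) :
    J * I ^ n = I ^ (n + 1) := by
  obtain ⟨d, rfl⟩ := Nat.exists_eq_add_of_le hsn
  rw [pow_add, ← mul_assoc, h, ← pow_add, add_right_comm]

theorem pow_mul_pow_eq {s : ℕ} (h : J * I ^ s = I ^ (s + 1)) (k : ℕ) :
    J ^ k * I ^ s = I ^ (k + s) := by
  induction k with
  | zero => simp
  | succ k ih => rw [pow_succ', mul_assoc, ih, mul_pow_eq_of_le h (by lia), add_right_comm]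

theorem IsReduction.radical_eq (hJ : IsReduction I J) : J.radical = I.radical := by
  obtain ⟨hJI, s, hs⟩ := hJ
  refine le_antisymm (Ideal.radical_mono hJI) ?_
  rw [← Ideal.radical_pow I s.succ_ne_zero]
  exact Ideal.radical_mono (hs.symm.le.trans Ideal.mul_le_left)

theorem IsReduction.map {S : Type*} [CommRing S] (hJ : IsReduction I J) (f : R →+* S) :
    IsReduction (I.map f) (J.map f) := by
  obtain ⟨hJI, s, hs⟩ := hJ
  exact ⟨Ideal.map_mono hJI, s, by rw [← Ideal.map_pow, ← Ideal.map_mul, hs, Ideal.map_pow]⟩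

theorem IsReduction.eventually_pow_le_reesComponent [IsNoetherianRing R] (hJ : IsReduction I J)
    {Q : Ideal (reesAlgebra I)} (hJQ : J ≤ reesComponent Q.radical 1) :
    ∀ᶠ n in atTop, I ^ n ≤ reesComponent Q n := by
  obtain ⟨-, s, hs⟩ := hJ
  obtain ⟨k, hk⟩ := Q.exists_radical_pow_le_of_fg (IsNoetherian.noetherian _)
  refine eventually_atTop.2 ⟨k + s, fun n hn => ?_⟩
  obtain ⟨d, rfl⟩ := Nat.exists_eq_add_of_le hn
  calc
    I ^ (k + s + d) = J ^ k * I ^ (s + d) := by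
      rw [pow_add, ← pow_mul_pow_eq hs, mul_assoc, pow_add]
    _ ≤ reesComponent (Q.radical ^ k) k * reesComponent ⊤ (s + d) :=
      Ideal.mul_mono ((Ideal.pow_right_mono hJQ k).trans (reesComponent_one_pow_le _ k))
        (reesComponent_top _).ge
    _ ≤ reesComponent (Q.radical ^ k * ⊤) (k + (s + d)) := reesComponent_mul_le _ _ _ _
    _ ≤ reesComponent Q (k + s + d) := by
      rw [Ideal.mul_top, add_assoc]
      exact reesComponent_mono hk _

end Reductions

section Superficial

variable {R : Type*} [CommRing R] {I J : Ideal R} {b : R}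

theorem pow_le_colon_singleton (hb : b ∈ I) (n : ℕ) : I ^ n ≤ (I ^ (n + 1)).colon {b} :=
  fun _ hz => Submodule.mem_colon_singleton.2 (pow_succ I n ▸ Ideal.mul_mem_mul hz hb)

theorem IsSuperficial.of_eventually (hb : b ∈ I)
    (h : ∀ᶠ n in atTop, I ^ n ⊓ (I ^ (n + 2)).colon {b} ≤ I ^ (n + 1)) : IsSuperficial I b := by
  obtain ⟨c, hc⟩ := eventually_atTop.1 h
  refine ⟨hb, c + 1, c.succ_pos, fun n hn => le_antisymm ?_
    (le_inf (pow_le_colon_singleton hb n) (Ideal.pow_le_pow_right hn))⟩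
  rintro z ⟨hzb, hzc⟩
  rw [SetLike.mem_coe, Submodule.mem_colon_singleton] at hzb
  have mem_pow : ∀ m, c + 1 ≤ m → m ≤ n → z ∈ I ^ m := by
    intro m hm
    induction m, hm using Nat.le_induction with
    | base => exact fun _ => hzc
    | succ m hcm ih =>
      exact fun hmn => hc m (by lia) ⟨ih (by lia), Submodule.mem_colon_singleton.2
        (Ideal.pow_le_pow_right (by lia) hzb)⟩
  exact mem_pow n hn le_rfl

theorem IsReduction.exists_isSuperficial [IsLocalRing R] [IsNoetherianRing R]
    [Infinite (ResidueField R)] (hJ : IsReduction I J) {T : Set (Ideal R)} (hT : T.Finite)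
    (hJT : ∀ p ∈ T, ¬ J ≤ p) : ∃ b ∈ J, (∀ p ∈ T, b ∉ p) ∧ IsSuperficial I b := by
  -- `b` has to avoid the degree one components of the associated primes of the associated graded
  -- ring of `I`, except those containing `J` there: their primary components contain `I ^ n t ^ n`
  -- for large `n`.
  obtain ⟨t, ht, ht_primary⟩ : ∃ t : Finset (Ideal (reesAlgebra I)),
      t.inf id = I.map (algebraMap R (reesAlgebra I)) ∧ ∀ ⦃Q⦄, Q ∈ t → Q.IsPrimary :=
    Submodule.isLasker _ _ _
  obtain ⟨b, hbJ, hb⟩ := exists_mem_forall_notMem (IsNoetherian.noetherian J)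
    (F := {K ∈ T ∪ (fun Q : Ideal (reesAlgebra I) => reesComponent Q.radical 1) '' t | ¬ J ≤ K})
    ((hT.union (t.finite_toSet.image _)).subset (Set.sep_subset _ _)) fun K hK => hK.2
  refine ⟨b, hbJ, fun p hp => hb p ⟨Or.inl hp, hJT p hp⟩, .of_eventually (hJ.1 hbJ) ?_⟩
  have eventually_le : ∀ Q ∈ t, ∀ᶠ n in atTop,
      I ^ n ⊓ (I ^ (n + 2)).colon {b} ≤ reesComponent Q n := by
    intro Q hQ
    by_cases hJQ : J ≤ reesComponent Q.radical 1
    · filter_upwards [hJ.eventually_pow_le_reesComponent hJQ] with n hn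
      exact inf_le_left.trans hn
    · have hbQ : b ∉ reesComponent Q.radical 1 := hb _ ⟨Or.inr ⟨Q, hQ, rfl⟩, hJQ⟩
      have htQ : I.map (algebraMap R (reesAlgebra I)) ≤ Q := ht ▸ Finset.inf_le hQ
      refine .of_forall fun n z hz => mem_reesComponent_of_mul_mem (ht_primary hQ) (hJ.1 hbJ) hbQ
        hz.1 (reesComponent_mono htQ _ ?_)
      rw [reesComponent_map_algebraMap]
      exact Submodule.mem_colon_singleton.1 hz.2
  filter_upwards [(eventually_all_finset t).2 eventually_le] with n hn z hz
  rw [← reesComponent_map_algebraMap, ← ht]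
  refine mem_reesComponent.2 ⟨hz.1, Submodule.mem_finsetInf.2 fun Q hQ => ?_⟩
  exact (mem_reesComponent.1 (hn Q hQ hz)).2

theorem IsSuperficial.eventually_colon_eq [IsNoetherianRing R] (hb : IsSuperficial I b)
    (hreg : IsSMulRegular R b) : ∀ᶠ n in atTop, (I ^ (n + 1)).colon {b} = I ^ n := by
  obtain ⟨hbI, c, -, hc⟩ := hb
  obtain ⟨k, hk⟩ := I.exists_pow_inf_eq_pow_smul (Ideal.span {b})
  filter_upwards [eventually_ge_atTop (k + c)] with n hn
  refine le_antisymm (fun z hz => ?_) (pow_le_colon_singleton hbI n)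
  have hzb : z * b ∈ I ^ (n + 1) ⊓ Ideal.span {b} :=
    ⟨Submodule.mem_colon_singleton.1 hz, Ideal.mul_mem_left _ z (Ideal.mem_span_singleton_self b)⟩
  have hzb' : z * b ∈ I ^ (n + 1 - k) * Ideal.span {b} := by
    have h := hk (n + 1) (by lia)
    simp only [smul_eq_mul, Ideal.mul_top] at h
    exact Ideal.mul_mono_right inf_le_right (h ▸ hzb)
  obtain ⟨w, hw, hwz⟩ := Ideal.mem_mul_span_singleton.1 hzb'
  obtain rfl : w = z := hreg (by simpa only [smul_eq_mul, mul_comm b] using hwz)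
  exact (hc n (by lia)).le ⟨hz, Ideal.pow_le_pow_right (by lia) hw⟩

theorem IsReduction.exists_isSMulRegular [IsLocalRing R] [IsNoetherianRing R]
    [Infinite (ResidueField R)] (hJ : IsReduction I J) (hI : maximalIdeal R ≤ I.radical)
    (hdepth : maximalIdeal R ∉ associatedPrimes R R) :
    ∃ b ∈ J, IsSMulRegular R b ∧ ∀ᶠ n in atTop, (I ^ (n + 1)).colon {b} = I ^ n := by
  obtain ⟨b, hbJ, hb, hbI⟩ := hJ.exists_isSuperficial (associatedPrimes.finite R R) <| by
    intro p hp hJp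
    have hp' : p.IsPrime := hp.isPrime
    have hmp : maximalIdeal R ≤ p := hI.trans (hJ.radical_eq ▸ hp'.radical_le_iff.2 hJp)
    exact hdepth (hmp.antisymm (le_maximalIdeal hp'.ne_top) ▸ hp)
  have hreg : IsSMulRegular R b := by
    by_contra hnot
    have : b ∈ ⋃ p ∈ associatedPrimes R R, (p : Set R) :=
      biUnion_associatedPrimes_eq_compl_regular R R ▸ hnot
    obtain ⟨p, hp, hbp⟩ := Set.mem_iUnion₂.1 this
    exact hb p hp hbp
  exact ⟨b, hbJ, hreg, hbI.eventually_colon_eq hreg⟩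

theorem IsReduction.sup_span_singleton {L : Ideal R} (hLI : L ≤ I) (hb : b ∈ I)
    (hcolon : ∀ᶠ n in atTop, (I ^ (n + 1)).colon {b} = I ^ n)
    (hL : IsReduction (I.map (Ideal.Quotient.mk (Ideal.span {b})))
      (L.map (Ideal.Quotient.mk (Ideal.span {b})))) :
    IsReduction I (L ⊔ Ideal.span {b}) := by
  obtain ⟨-, s, hs⟩ := hL
  obtain ⟨n, hsn, hn⟩ := ((eventually_ge_atTop s).and hcolon).exists
  have hLb : L ⊔ Ideal.span {b} ≤ I := sup_le hLI ((Ideal.span_singleton_le_iff_mem I).2 hb)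
  refine ⟨hLb, n, le_antisymm (pow_succ' I n ▸ Ideal.mul_mono_left hLb) fun z hz => ?_⟩
  have hmem := Ideal.mem_map_of_mem (Ideal.Quotient.mk (Ideal.span {b})) hz
  rw [Ideal.map_pow, ← mul_pow_eq_of_le hs hsn, ← Ideal.map_pow, ← Ideal.map_mul,
    Ideal.mem_map_iff_of_surjective _ Ideal.Quotient.mk_surjective] at hmem
  obtain ⟨y, hy, hyz⟩ := hmem
  obtain ⟨w, hw⟩ := Ideal.mem_span_singleton'.1 (Ideal.Quotient.eq.1 hyz.symm)
  have hyI : y ∈ I ^ (n + 1) := pow_succ' I n ▸ Ideal.mul_mono_left hLI hy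
  have hwI : w ∈ I ^ n := hn.le <| Submodule.mem_colon_singleton.2 <| by
    rw [smul_eq_mul, hw]
    exact sub_mem hz hyI
  rw [← add_sub_cancel y z, ← hw, Ideal.sup_mul, mul_comm w]
  exact Submodule.add_mem_sup hy (Ideal.mul_mem_mul (Ideal.mem_span_singleton_self b) hwI)

theorem isReduction_span_singleton (hb : b ∈ I)
    (hcolon : ∀ᶠ n in atTop, (I ^ (n + 1)).colon {b} = I ^ n) {N : ℕ}
    (hN : I ^ N ≤ Ideal.span {b}) : IsReduction I (Ideal.span {b}) := by
  have hnil : I.map (Ideal.Quotient.mk (Ideal.span {b})) ^ (N + 1) = ⊥ := by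
    rw [← Ideal.map_pow, Ideal.map_eq_bot_iff_le_ker, Ideal.mk_ker]
    exact (Ideal.pow_le_pow_right N.le_succ).trans hN
  have h := IsReduction.sup_span_singleton bot_le hb hcolon
    ⟨Ideal.map_mono bot_le, N, by rw [Ideal.map_bot, Ideal.bot_mul, hnil]⟩
  rwa [bot_sup_eq] at h

end Superficial

section RegularSequences

variable {R : Type*} [CommRing R]

theorem mem_span_singleton_of_mul_mem {x y : R} (hx : IsSMulRegular R x)
    (hy : IsSMulRegular (R ⧸ Ideal.span {x}) y) {a z : R} (ha : IsSMulRegular R a)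
    (hzx : z * x ∈ Ideal.span {a}) (hzy : z * y ∈ Ideal.span {a}) : z ∈ Ideal.span {a} := by
  obtain ⟨u, hu⟩ := Ideal.mem_span_singleton'.1 hzx
  obtain ⟨v, hv⟩ := Ideal.mem_span_singleton'.1 hzy
  have huv : u * y = v * x := ha (by linear_combination y * hu - x * hv)
  obtain ⟨w, rfl⟩ := Ideal.mem_span_singleton'.1 <|
    mem_of_isSMulRegular_quotient_of_smul_mem (N := Ideal.span {x}) (x := u) hy <| by
      rw [smul_eq_mul, mul_comm, huv]
      exact Ideal.mul_mem_left _ v (Ideal.mem_span_singleton_self x)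
  exact Ideal.mem_span_singleton'.2 ⟨w, hx (by linear_combination hu)⟩

open scoped Pointwise in
theorem isSMulRegular_pair_of_isWeaklyRegular {x y : R}
    (h : RingTheory.Sequence.IsWeaklyRegular R [x, y]) :
    IsSMulRegular R x ∧ IsSMulRegular (R ⧸ Ideal.span {x}) y := by
  rw [RingTheory.Sequence.isWeaklyRegular_cons_iff,
    RingTheory.Sequence.isWeaklyRegular_singleton_iff] at h
  refine ⟨h.1, ?_⟩
  have hxy : Ideal.span {x} = x • (⊤ : Submodule R R) := by
    rw [← Submodule.ideal_span_singleton_smul, smul_eq_mul, Ideal.mul_top]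
  rw [hxy]
  exact h.2

theorem IsCohenMacaulayLocal.exists_isSMulRegular_pair [IsLocalRing R]
    (hR : IsCohenMacaulayLocal R) (hdim : ringKrullDim R = 2) :
    ∃ x ∈ maximalIdeal R, ∃ y ∈ maximalIdeal R,
      IsSMulRegular R x ∧ IsSMulRegular (R ⧸ Ideal.span {x}) y := by
  obtain ⟨rs, hrs, hreg, hlen⟩ := hR.exists_regular
  have hlen' : rs.length = 2 := by exact_mod_cast hlen.trans hdim
  obtain ⟨x, y, rfl⟩ := List.length_eq_two.1 hlen'
  exact ⟨x, hrs x (by simp), y, hrs y (by simp),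
    isSMulRegular_pair_of_isWeaklyRegular hreg.toIsWeaklyRegular⟩

theorem krullDimLE_quotient_span_singleton {n : ℕ} [Ring.KrullDimLE (n + 1) R] {b : R}
    (hb : IsSMulRegular R b) : Ring.KrullDimLE n (R ⧸ Ideal.span {b}) := by
  have hb' : b ∈ nonZeroDivisors R := by
    rw [← nonZeroDivisorsLeft_eq_nonZeroDivisors]
    exact fun z hz => hb (by simpa [mul_comm] using hz)
  have h := (ringKrullDim_quotient_succ_le_of_nonZeroDivisor hb').trans
    (Ring.krullDimLE_iff.1 ‹Ring.KrullDimLE (n + 1) R›)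
  exact Ring.krullDimLE_iff.2 (ENat.WithBot.add_le_add_natCast_right_iff.1 h)

theorem exists_maximalIdeal_pow_le_span_singleton [IsLocalRing R] [IsNoetherianRing R]
    [Ring.KrullDimLE 1 R] {b : R} (hb : IsSMulRegular R b) :
    ∃ N, maximalIdeal R ^ N ≤ Ideal.span {b} := by
  have := krullDimLE_quotient_span_singleton (n := 0) hb
  have : IsArtinianRing (R ⧸ Ideal.span {b}) := IsNoetherianRing.isArtinianRing_of_krullDimLE_zero
  exact exists_maximalIdeal_pow_le_of_isArtinianRing_quotient _

theorem maximalIdeal_notMem_associatedPrimes [IsLocalRing R] [IsNoetherianRing R]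
    (h : ∀ z : R, (∀ w ∈ maximalIdeal R, z * w = 0) → z = 0) :
    maximalIdeal R ∉ associatedPrimes R R := by
  intro hmem
  obtain ⟨hprime, z, hz⟩ := isAssociatedPrime_iff.1 hmem
  refine hprime.ne_top (hz.trans ?_)
  rw [h z fun w hw => ?_]
  · simp
  · rw [hz, Submodule.mem_colon_singleton, Submodule.mem_bot, smul_eq_mul, mul_comm] at hw
    exact hw

theorem IsReduction.exists_isReduction_span_singleton [IsLocalRing R] [IsNoetherianRing R]
    [Ring.KrullDimLE 1 R] [Infinite (ResidueField R)] {I J : Ideal R} (hJ : IsReduction I J)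
    (hI : I.radical = maximalIdeal R) (hdepth : maximalIdeal R ∉ associatedPrimes R R) :
    ∃ b ∈ J, IsSMulRegular R b ∧ IsReduction I (Ideal.span {b}) := by
  obtain ⟨b, hbJ, hb, hcolon⟩ := hJ.exists_isSMulRegular hI.ge hdepth
  obtain ⟨N, hN⟩ := exists_maximalIdeal_pow_le_span_singleton hb
  have hIm : I ≤ maximalIdeal R := hI ▸ Ideal.le_radical
  exact ⟨b, hbJ, hb, isReduction_span_singleton (hJ.1 hbJ) hcolon
    ((Ideal.pow_right_mono hIm N).trans hN)⟩

/-- A pair `a, b` generating a reduction of `I`, with `b` regular modulo `a`, such that the colon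
ideals `(I ^ (n + 1) : a)` and `I ^ n` agree for large `n`: a regular element `a` that is
superficial for `I` has this last property. These are the generators of the minimal reductions of
an `𝔪`-primary ideal of a two-dimensional Cohen-Macaulay local ring. -/
structure IsSuperficialReduction (I : Ideal R) (a b : R) : Prop where
  isReduction : IsReduction I (Ideal.span {a, b})
  isSMulRegular : IsSMulRegular (R ⧸ Ideal.span {a}) b
  eventually_colon_eq : ∀ᶠ n in atTop, (I ^ (n + 1)).colon {a} = I ^ n

theorem radical_map_eq_maximalIdeal [IsLocalRing R] {A : Type*} [CommRing A] [IsLocalRing A]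
    {f : R →+* A} [IsLocalHom f] (hf : Function.Surjective f) {I : Ideal R}
    (hI : I.radical = maximalIdeal R) : (I.map f).radical = maximalIdeal A := by
  refine le_antisymm ?_ fun y hy => ?_
  · refine (maximalIdeal.isMaximal A).isPrime.radical_le_iff.2 ?_
    exact (Ideal.map_mono (hI ▸ Ideal.le_radical)).trans (map_maximalIdeal_le f)
  · obtain ⟨y, rfl⟩ := hf y
    rw [← Ideal.mem_comap, maximalIdeal_comap, ← hI] at hy
    obtain ⟨n, hn⟩ := hy
    exact ⟨n, map_pow f y n ▸ Ideal.mem_map_of_mem f hn⟩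

theorem maximalIdeal_notMem_associatedPrimes_quotient [IsLocalRing R] [IsNoetherianRing R]
    {x y a : R} (hxm : x ∈ maximalIdeal R) (hym : y ∈ maximalIdeal R) (hx : IsSMulRegular R x)
    (hy : IsSMulRegular (R ⧸ Ideal.span {x}) y) (ha : IsSMulRegular R a)
    [IsLocalRing (R ⧸ Ideal.span {a})] :
    maximalIdeal (R ⧸ Ideal.span {a}) ∉
      associatedPrimes (R ⧸ Ideal.span {a}) (R ⧸ Ideal.span {a}) := by
  set f := Ideal.Quotient.mk (Ideal.span {a})
  have : IsLocalHom f := .of_surjective f Ideal.Quotient.mk_surjective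
  refine maximalIdeal_notMem_associatedPrimes fun z hz => ?_
  obtain ⟨z, rfl⟩ := Ideal.Quotient.mk_surjective z
  have mul_mem : ∀ w ∈ maximalIdeal R, z * w ∈ Ideal.span {a} := fun w hw =>
    Ideal.Quotient.eq_zero_iff_mem.1 ((map_mul f z w).trans (hz _ (map_nonunit f w hw)))
  exact Ideal.Quotient.eq_zero_iff_mem.2
    (mem_span_singleton_of_mul_mem hx hy ha (mul_mem x hxm) (mul_mem y hym))

theorem IsReduction.exists_isSuperficialReduction [IsLocalRing R] [Infinite (ResidueField R)]
    (hR : IsCohenMacaulayLocal R) (hdim : ringKrullDim R = 2) {I J : Ideal R}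
    (hI : I.radical = maximalIdeal R) (hJ : IsReduction I J) :
    ∃ a ∈ J, ∃ b ∈ J, IsSuperficialReduction I a b := by
  have := hR.noetherian
  have : Ring.KrullDimLE 2 R := Ring.krullDimLE_iff.2 hdim.le
  obtain ⟨x, hxm, y, hym, hx, hy⟩ := hR.exists_isSMulRegular_pair hdim
  obtain ⟨a, haJ, ha, hcolon⟩ := hJ.exists_isSMulRegular hI.ge <|
    maximalIdeal_notMem_associatedPrimes fun z hz => hx <| by
      simpa only [smul_eq_mul, mul_zero, mul_comm] using hz x hxm
  set f := Ideal.Quotient.mk (Ideal.span {a})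
  have hf : Function.Surjective f := Ideal.Quotient.mk_surjective
  have hIm : I ≤ maximalIdeal R := hI ▸ Ideal.le_radical
  have : Nontrivial (R ⧸ Ideal.span {a}) := Ideal.Quotient.nontrivial_iff.2 fun h =>
    (mem_maximalIdeal a).1 (hIm (hJ.1 haJ)) (Ideal.span_singleton_eq_top.1 h)
  have : IsLocalRing (R ⧸ Ideal.span {a}) := .of_surjective' f hf
  have : IsLocalHom f := .of_surjective f hf
  have : Infinite (ResidueField (R ⧸ Ideal.span {a})) :=
    .of_injective _ (ResidueField.map f).injective
  have : Ring.KrullDimLE 1 (R ⧸ Ideal.span {a}) := krullDimLE_quotient_span_singleton ha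
  obtain ⟨b', hb'J, hb', hred⟩ := (hJ.map f).exists_isReduction_span_singleton
    (radical_map_eq_maximalIdeal hf hI)
    (maximalIdeal_notMem_associatedPrimes_quotient hxm hym hx hy ha)
  obtain ⟨b, hbJ, rfl⟩ := (Ideal.mem_map_iff_of_surjective f hf).1 hb'J
  refine ⟨a, haJ, b, hbJ, ?_, (isSMulRegular_algebraMap_iff (R ⧸ Ideal.span {a})).1 hb', hcolon⟩
  rw [Ideal.span_pair_comm, Ideal.span_insert]
  refine IsReduction.sup_span_singleton
    ((Ideal.span_singleton_le_iff_mem I).2 (hJ.1 hbJ)) (hJ.1 haJ) hcolon ?_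
  rwa [Ideal.map_span, Set.image_singleton]

end RegularSequences

section Colength

variable {R : Type*} [CommRing R] {K L : Ideal R}

/-- The colength `λ(R / K)` of an ideal, as a natural number; it is `0` if the length is
infinite. -/
noncomputable def colength (K : Ideal R) : ℕ := (Module.length R (R ⧸ K)).toNat

theorem isFiniteLength_quotient_of_le (hK : IsFiniteLength R (R ⧸ K)) (hKL : K ≤ L) :
    IsFiniteLength R (R ⧸ L) :=
  hK.of_surjective (Submodule.factor_surjective hKL)

theorem isFiniteLength_quotient_of_maximalIdeal_le_radical [IsLocalRing R] [IsNoetherianRing R]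
    (hK : maximalIdeal R ≤ K.radical) : IsFiniteLength R (R ⧸ K) := by
  rcases eq_or_ne K ⊤ with rfl | hK_top
  · have : Subsingleton (R ⧸ (⊤ : Ideal R)) := Ideal.Quotient.subsingleton_iff.2 rfl
    exact .of_subsingleton
  · have hmin : maximalIdeal R ∈ K.minimalPrimes :=
      ⟨⟨inferInstance, le_maximalIdeal hK_top⟩, fun p hp _ =>
        hK.trans (hp.1.radical_le_iff.2 hp.2)⟩
    have := quotient_artinian_of_mem_minimalPrimes_of_isLocalRing K hmin
    exact isFiniteLength_iff_isNoetherian_isArtinian.2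
      ⟨inferInstance, isArtinian_of_surjective_algebraMap (Ideal.Quotient.mk_surjective (I := K))⟩

theorem isFiniteLength_quotient_pow [IsLocalRing R] [IsNoetherianRing R]
    (hK : maximalIdeal R ≤ K.radical) (n : ℕ) : IsFiniteLength R (R ⧸ K ^ n) := by
  refine isFiniteLength_quotient_of_maximalIdeal_le_radical ?_
  rcases eq_or_ne n 0 with rfl | hn
  · rw [pow_zero, Ideal.one_eq_top, Ideal.radical_top]
    exact le_top
  · rwa [K.radical_pow hn]

theorem colength_top : colength (⊤ : Ideal R) = 0 := by
  have : Subsingleton (R ⧸ (⊤ : Ideal R)) := Ideal.Quotient.subsingleton_iff.2 rfl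
  rw [colength, Module.length_eq_zero, ENat.toNat_zero]

theorem length_quotient_eq_add (K : Ideal R) (a : R) :
    Module.length R (R ⧸ K) =
      Module.length R (R ⧸ K.colon {a}) + Module.length R (R ⧸ K ⊔ Ideal.span {a}) := by
  let f : R →ₗ[R] R ⧸ K := LinearMap.toSpanSingleton R (R ⧸ K) (Submodule.Quotient.mk a)
  have hker : LinearMap.ker f = K.colon {a} := by
    ext z
    rw [Submodule.mem_colon_singleton, LinearMap.mem_ker, LinearMap.toSpanSingleton_apply,
      ← Submodule.Quotient.mk_smul, Submodule.Quotient.mk_eq_zero]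
  have hrange : LinearMap.range f = Submodule.map K.mkQ (Ideal.span {a}) := by
    rw [← LinearMap.span_singleton_eq_range, Ideal.span, Submodule.map_span, Set.image_singleton]
    rfl
  rw [Module.length_eq_add_of_exact (LinearMap.range f).subtype (LinearMap.range f).mkQ
    (Submodule.subtype_injective _) (Submodule.mkQ_surjective _)
    (LinearMap.exact_subtype_mkQ _), ← f.quotKerEquivRange.length_eq, hker, hrange,
    (Submodule.quotientQuotientEquivQuotientSup K (Ideal.span {a})).length_eq]

theorem colength_eq_add (hK : IsFiniteLength R (R ⧸ K)) (a : R) :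
    colength K = colength (K.colon {a}) + colength (K ⊔ Ideal.span {a}) := by
  rw [colength, length_quotient_eq_add K a, ENat.toNat_add
    (Module.length_ne_top_iff.2 (isFiniteLength_quotient_of_le hK Ideal.le_colon))
    (Module.length_ne_top_iff.2 (isFiniteLength_quotient_of_le hK le_sup_left))]
  rfl

theorem eq_of_le_of_colength_eq (hK : IsFiniteLength R (R ⧸ K)) (hKL : K ≤ L)
    (h : colength K = colength L) : K = L := by
  obtain ⟨_, _⟩ := isFiniteLength_iff_isNoetherian_isArtinian.1 hK
  by_contra hne
  have hlt : Module.length R (R ⧸ L) < Module.length R (R ⧸ K) := by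
    rw [← (Submodule.quotientQuotientEquivQuotient K L hKL).length_eq]
    refine Submodule.length_quotient_lt _ fun hbot => hne (hKL.antisymm ?_)
    rwa [← Submodule.ker_mkQ K, LinearMap.le_ker_iff_map]
  have hK' := ENat.natCast_toNat (Module.length_ne_top_iff.2 hK)
  have hL' := ENat.natCast_toNat (hlt.trans_le le_top).ne
  rw [← hK', ← hL', Nat.cast_lt] at hlt
  exact hlt.ne' h

variable {I : Ideal R} {a b : R}

theorem colon_pow_sup_eq (hb : IsSMulRegular (R ⧸ Ideal.span {a}) b) {n : ℕ}
    (hn : Ideal.span {a, b} * I ^ n = I ^ (n + 1)) :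
    (I ^ (n + 1) ⊔ Ideal.span {a}).colon {b} = I ^ n ⊔ Ideal.span {a} := by
  ext z
  rw [Submodule.mem_colon_singleton, smul_eq_mul, ← hn, Ideal.span_insert, Ideal.sup_mul,
    sup_right_comm, sup_eq_right.2 (Ideal.mul_le_left : Ideal.span {a} * I ^ n ≤ _), sup_comm]
  constructor
  · intro hz
    obtain ⟨y, hy, l, hl, hyl⟩ := Submodule.mem_sup.1 hz
    obtain ⟨w, hw, rfl⟩ := Ideal.mem_span_singleton_mul.1 hy
    have hzw : z - w ∈ Ideal.span {a} := mem_of_isSMulRegular_quotient_of_smul_mem hb <| by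
      rwa [smul_eq_mul, show b * (z - w) = l by linear_combination -hyl]
    rw [← add_sub_cancel w z]
    exact Submodule.add_mem_sup hw hzw
  · intro hz
    obtain ⟨w, hw, l, hl, rfl⟩ := Submodule.mem_sup.1 hz
    rw [add_mul, mul_comm w]
    exact Submodule.add_mem_sup (Ideal.mul_mem_mul (Ideal.mem_span_singleton_self b) hw)
      (Ideal.mul_mem_right b _ hl)

theorem colength_pow_sup_add (hI : ∀ n, IsFiniteLength R (R ⧸ I ^ n))
    (hb : IsSMulRegular (R ⧸ Ideal.span {a}) b) {r : ℕ}
    (hr : Ideal.span {a, b} * I ^ r = I ^ (r + 1)) (d : ℕ) :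
    colength (I ^ (r + d) ⊔ Ideal.span {a}) =
      colength (I ^ r ⊔ Ideal.span {a}) + d * colength (Ideal.span {a, b}) := by
  induction d with
  | zero => simp
  | succ d ih =>
    have hn := mul_pow_eq_of_le hr (Nat.le_add_right r d)
    have hsup : I ^ (r + d + 1) ⊔ Ideal.span {a} ⊔ Ideal.span {b} = Ideal.span {a, b} := by
      rw [sup_assoc, ← Ideal.span_insert, sup_eq_right, ← hn]
      exact Ideal.mul_le_left
    rw [← add_assoc, colength_eq_add (isFiniteLength_quotient_of_le (hI _) le_sup_left) b, hsup,
      colon_pow_sup_eq hb hn, ih]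
    ring

end Colength

section HilbertPolynomial

variable {R : Type*} [CommRing R] {I : Ideal R} {a b : R}

theorem hilbertFun_of_nonpos (I : Ideal R) {t : ℤ} (ht : t ≤ 0) : hilbertFun I t = 0 := by
  change colength (I ^ t.toNat) = 0
  rw [Int.toNat_of_nonpos ht, pow_zero, Ideal.one_eq_top, colength_top]

theorem eq_of_infinite_eval_intCast_eq {P Q : ℚ[X]}
    (h : {t : ℤ | P.eval (t : ℚ) = Q.eval (t : ℚ)}.Infinite) : P = Q :=
  eq_of_infinite_eval_eq P Q <| (h.image Int.cast_injective.injOn).mono <|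
    Set.image_subset_iff.2 fun _ ht => ht

theorem hilbertPoly_eq {Q : ℚ[X]}
    (hQ : ∀ᶠ t : ℤ in atTop, Q.eval (t : ℚ) = hilbertFun I t) : hilbertPoly I = Q := by
  obtain ⟨N, hN⟩ := eventually_atTop.1 hQ
  have hex : ∃ P : ℚ[X], ∃ N : ℤ, ∀ n : ℤ, N ≤ n → P.eval (n : ℚ) = (hilbertFun I n : ℚ) :=
    ⟨Q, N, hN⟩
  rw [hilbertPoly, dif_pos hex]
  obtain ⟨N', hN'⟩ := hex.choose_spec
  exact eq_of_infinite_eval_intCast_eq <| (Set.Ici_infinite (max N N')).mono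
    fun t ht => (hN' t (le_of_max_le_right ht)).trans (hN t (le_of_max_le_left ht)).symm

theorem exists_quadratic_of_eventually_step {f : ℤ → ℚ} {α β : ℚ}
    (hf : ∀ᶠ t in atTop, f (t + 1) = f t + (α + β * t)) :
    ∃ Q : ℚ[X], (∀ᶠ t : ℤ in atTop, Q.eval (t : ℚ) = f t) ∧
      ∀ t : ℤ, Q.eval ((t + 1 : ℤ) : ℚ) = Q.eval (t : ℚ) + (α + β * t) := by
  obtain ⟨N, hN⟩ := eventually_atTop.1 hf
  let Q₀ : ℚ[X] := C (β / 2) * (X * (X - C 1)) + C α * X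
  let Q : ℚ[X] := Q₀ + C (f N - Q₀.eval (N : ℚ))
  have hstep (t : ℤ) : Q.eval ((t + 1 : ℤ) : ℚ) = Q.eval (t : ℚ) + (α + β * t) := by
    simp only [Q, Q₀, eval_add, eval_mul, eval_sub, eval_C, eval_X]
    push_cast
    ring
  refine ⟨Q, eventually_atTop.2 ⟨N, fun t ht => ?_⟩, hstep⟩
  induction t, ht using Int.leInduction with
  | base => simp only [Q, eval_add, eval_C, add_sub_cancel]
  | succ t ht ih => rw [hstep, ih, hN t ht]

theorem exists_hilbertPoly_eval_ne (hI : IsFiniteLength R (R ⧸ I)) (hI_top : I ≠ ⊤) :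
    ∃ t : ℤ, (hilbertPoly I).eval (t : ℚ) ≠ hilbertFun I t := by
  by_contra! hall
  have hzero : hilbertPoly I = 0 := eq_of_infinite_eval_intCast_eq <|
    (Set.Iic_infinite (0 : ℤ)).mono fun t ht => by
      rw [Set.mem_ofPred, hall t, hilbertFun_of_nonpos I ht, Nat.cast_zero, eval_zero]
  have hcolength : colength I = 0 := by
    have h := hall 1
    rw [hzero, eval_zero, eq_comm, Nat.cast_eq_zero] at h
    rwa [← pow_one I]
  exact hI_top (eq_of_le_of_colength_eq hI le_top (hcolength.trans colength_top.symm))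

theorem isLeast_postulationNumber
    (hP : ∀ᶠ t : ℤ in atTop, (hilbertPoly I).eval (t : ℚ) = hilbertFun I t)
    (hI : IsFiniteLength R (R ⧸ I)) (hI_top : I ≠ ⊤) :
    IsLeast {n : ℤ | ∀ t, n < t → (hilbertPoly I).eval (t : ℚ) = hilbertFun I t}
      (postulationNumber I) := by
  obtain ⟨N, hN⟩ := eventually_atTop.1 hP
  obtain ⟨t₀, ht₀⟩ := exists_hilbertPoly_eval_ne hI hI_top
  have hbdd : BddBelow {n : ℤ | ∀ t, n < t → (hilbertPoly I).eval (t : ℚ) = hilbertFun I t} :=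
    ⟨t₀, fun n hn => not_lt.1 fun hlt => ht₀ (hn t₀ hlt)⟩
  exact ⟨Int.csInf_mem ⟨N, fun t ht => hN t ht.le⟩ hbdd, fun n hn => csInf_le hbdd hn⟩

theorem hilbertPoly_eval_ne_of_isLeast {n : ℤ}
    (hn : IsLeast {n : ℤ | ∀ t, n < t → (hilbertPoly I).eval (t : ℚ) = hilbertFun I t} n) :
    (hilbertPoly I).eval (n : ℚ) ≠ hilbertFun I n := by
  intro heq
  refine (sub_one_lt n).not_ge (hn.2 fun t ht => ?_)
  rcases (Int.sub_one_lt_iff.1 ht).eq_or_lt with rfl | hlt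
  · exact heq
  · exact hn.1 t hlt

theorem exists_hilbertFun_add_one_eq (hI : ∀ n, IsFiniteLength R (R ⧸ I ^ n))
    (hb : IsSMulRegular (R ⧸ Ideal.span {a}) b) {r : ℕ}
    (hr : Ideal.span {a, b} * I ^ r = I ^ (r + 1)) :
    ∃ α : ℚ, ∀ t : ℤ, r ≤ t + 1 → (hilbertFun I (t + 1) : ℚ) =
      colength ((I ^ (t + 1).toNat).colon {a}) + (α + colength (Ideal.span {a, b}) * t) := by
  refine ⟨colength (I ^ r ⊔ Ideal.span {a}) + (1 - r) * colength (Ideal.span {a, b}),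
    fun t ht => ?_⟩
  obtain ⟨d, hd⟩ := Int.le.dest ht
  have htoNat : (t + 1).toNat = r + d := by lia
  have hd' : (r : ℚ) + d = t + 1 := by exact_mod_cast hd
  change (colength (I ^ (t + 1).toNat) : ℚ) = _
  rw [htoNat, colength_eq_add (hI _) a, colength_pow_sup_add hI hb hr]
  push_cast
  linear_combination (colength (Ideal.span {a, b}) : ℚ) * hd'

theorem IsSuperficialReduction.exists_hilbertPoly_step (hI : ∀ n, IsFiniteLength R (R ⧸ I ^ n))
    (hab : IsSuperficialReduction I a b) {r : ℕ}
    (hr : Ideal.span {a, b} * I ^ r = I ^ (r + 1)) :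
    (∀ᶠ t : ℤ in atTop, (hilbertPoly I).eval (t : ℚ) = hilbertFun I t) ∧
    ∃ α : ℚ, (∀ t : ℤ, (hilbertPoly I).eval ((t + 1 : ℤ) : ℚ) =
        (hilbertPoly I).eval (t : ℚ) + (α + colength (Ideal.span {a, b}) * t)) ∧
      ∀ t : ℤ, r ≤ t + 1 → (hilbertFun I (t + 1) : ℚ) =
        colength ((I ^ (t + 1).toNat).colon {a}) + (α + colength (Ideal.span {a, b}) * t) := by
  obtain ⟨α, hα⟩ := exists_hilbertFun_add_one_eq hI hab.isSMulRegular hr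
  obtain ⟨N, hN⟩ := eventually_atTop.1 hab.eventually_colon_eq
  have hstep : ∀ᶠ t : ℤ in atTop, (hilbertFun I (t + 1) : ℚ) =
      hilbertFun I t + (α + colength (Ideal.span {a, b}) * t) := by
    filter_upwards [eventually_ge_atTop ((N + r : ℕ) : ℤ)] with t ht
    rw [hα t (by lia), show (t + 1).toNat = t.toNat + 1 by lia, hN _ (by lia)]
    rfl
  obtain ⟨Q, hQ, hQstep⟩ := exists_quadratic_of_eventually_step
    (f := fun t => (hilbertFun I t : ℚ)) hstep
  obtain rfl := hilbertPoly_eq hQ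
  exact ⟨hQ, α, hQstep, hα⟩

theorem IsSuperficialReduction.colength_span_pair_eq (hI : ∀ n, IsFiniteLength R (R ⧸ I ^ n))
    {a' b' : R} (hab : IsSuperficialReduction I a b) (hab' : IsSuperficialReduction I a' b') :
    colength (Ideal.span {a, b}) = colength (Ideal.span {a', b'}) := by
  obtain ⟨-, r, hr⟩ := hab.isReduction
  obtain ⟨-, r', hr'⟩ := hab'.isReduction
  obtain ⟨-, α, hα, -⟩ := hab.exists_hilbertPoly_step hI hr
  obtain ⟨-, α', hα', -⟩ := hab'.exists_hilbertPoly_step hI hr'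
  have h0 := (hα 0).symm.trans (hα' 0)
  have h1 := (hα 1).symm.trans (hα' 1)
  push_cast at h0 h1
  exact_mod_cast (by linarith :
    (colength (Ideal.span {a, b}) : ℚ) = colength (Ideal.span {a', b'}))

theorem IsSuperficialReduction.colength_colon_eq (hI : ∀ n, IsFiniteLength R (R ⧸ I ^ n))
    (hab : IsSuperficialReduction I a b) {r : ℕ}
    (hr : Ideal.span {a, b} * I ^ r = I ^ (r + 1)) {t : ℤ} (hrt : r ≤ t + 1)
    (ht : (hilbertPoly I).eval ((t + 1 : ℤ) : ℚ) = hilbertFun I (t + 1)) :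
    (colength ((I ^ (t + 1).toNat).colon {a}) : ℚ) = (hilbertPoly I).eval (t : ℚ) := by
  obtain ⟨-, α, hα, hα'⟩ := hab.exists_hilbertPoly_step hI hr
  linarith [hα t, hα' t hrt]

end HilbertPolynomial

section RatliffRushClosure

variable {R : Type*} [CommRing R] {I : Ideal R} {a : R}

theorem pow_colon_pow_eq {m : ℕ} (hcolon : ∀ t, m ≤ t → (I ^ (t + 1)).colon {a} = I ^ t)
    (j : ℕ) : (I ^ (m + j)).colon {a ^ j} = I ^ m := by
  induction j with
  | zero =>
    ext z
    rw [Submodule.mem_colon_singleton, pow_zero, smul_eq_mul, mul_one, add_zero]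
  | succ j ih =>
    ext z
    rw [← ih, ← hcolon (m + j) (by lia)]
    simp only [Submodule.mem_colon_singleton, smul_eq_mul, pow_succ, mul_assoc, add_assoc]

theorem closure_pow_eq (ha : a ∈ I) {m : ℕ}
    (hcolon : ∀ t, m ≤ t → (I ^ (t + 1)).colon {a} = I ^ t) : closure (I ^ m) = I ^ m := by
  refine le_antisymm (iSup₂_le fun j _ => ?_)
    (le_iSup₂_of_le 1 le_rfl fun z hz => Submodule.mem_colon.2 fun w hw => ?_)
  · rw [← pow_mul, ← pow_mul, ← pow_colon_pow_eq hcolon (m * j), mul_add_one, add_comm]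
    exact Submodule.colon_mono le_rfl (Set.singleton_subset_iff.2 (Ideal.pow_mem_pow ha _))
  · rw [pow_succ']
    exact Ideal.mul_mem_mul hz hw

theorem pow_colon_eq_of_closure_pow_eq (ha : a ∈ I)
    (hcolon : ∀ᶠ n in atTop, (I ^ (n + 1)).colon {a} = I ^ n) {t : ℕ} (ht : t ≠ 0)
    (hclosure : closure (I ^ t) = I ^ t) : (I ^ (t + 1)).colon {a} = I ^ t := by
  refine le_antisymm (fun z hz => ?_) (pow_le_colon_singleton ha t)
  obtain ⟨c, hc⟩ := eventually_atTop.1 hcolon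
  have hle : ((I ^ t) ^ (c + 1 + 1)).colon (((I ^ t) ^ (c + 1) : Ideal R) : Set R) ≤ I ^ t :=
    (le_iSup₂_of_le (c + 1) (by lia) le_rfl).trans hclosure.le
  refine hle (Submodule.mem_colon.2 fun w hw => ?_)
  rw [SetLike.mem_coe, ← pow_mul] at hw
  rw [← pow_mul, ← hc (t * (c + 1 + 1)) (by nlinarith [Nat.pos_of_ne_zero ht]),
    Submodule.mem_colon_singleton]
  rw [Submodule.mem_colon_singleton] at hz
  rw [show t * (c + 1 + 1) + 1 = (t + 1) + t * (c + 1) by ring, pow_add]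
  convert Ideal.mul_mem_mul hz hw using 1
  simp only [smul_eq_mul, mul_right_comm]

theorem stabilityIndex_eq (ha : a ∈ I) {n : ℕ}
    (hgood : ∀ t, n < t → (I ^ (t + 1)).colon {a} = I ^ t) (hn : (I ^ (n + 1)).colon {a} ≠ I ^ n) :
    stabilityIndex I = n + 1 := by
  refine IsLeast.csInf_eq ⟨⟨n.succ_pos, fun m hm => closure_pow_eq ha fun t ht => hgood t
    (hm.trans ht)⟩, fun i ⟨hi, hclosure⟩ => Nat.succ_le_of_lt (not_le.1 fun hin => hn ?_)⟩
  exact pow_colon_eq_of_closure_pow_eq ha (eventually_atTop.2 ⟨n + 1, hgood⟩) (by lia)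
    (hclosure n hin)

end RatliffRushClosure

section ReductionNumber

variable {R : Type*} [CommRing R] {I : Ideal R} {a b : R}

theorem IsSuperficialReduction.postulationNumber_eq (hI : ∀ n, IsFiniteLength R (R ⧸ I ^ n))
    (hI_top : I ≠ ⊤) (hab : IsSuperficialReduction I a b) {r : ℕ}
    (hr : Ideal.span {a, b} * I ^ r = I ^ (r + 1)) (hrn : r ≤ postulationNumber I + 1) :
    postulationNumber I = stabilityIndex I - 1 := by
  have ha : a ∈ I := hab.isReduction.1 (Ideal.subset_span (Set.mem_insert a {b}))
  have hleast := isLeast_postulationNumber (hab.exists_hilbertPoly_step hI hr).1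
    (pow_one I ▸ hI 1) hI_top
  have hne := hilbertPoly_eval_ne_of_isLeast hleast
  have hcolon : ∀ t, postulationNumber I ≤ t →
      (colength ((I ^ (t + 1).toNat).colon {a}) : ℚ) = (hilbertPoly I).eval (t : ℚ) :=
    fun t ht => hab.colength_colon_eq hI hr (by lia) (hleast.1 _ (by lia))
  have hnonneg : 0 ≤ postulationNumber I := by
    by_contra! hneg
    refine hne ?_
    rw [← hcolon _ le_rfl, hilbertFun_of_nonpos I hneg.le, Int.toNat_of_nonpos hneg, pow_zero,
      Ideal.one_eq_top, Submodule.top_colon, colength_top]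
  obtain ⟨n, hn⟩ := Int.eq_ofNat_of_zero_le hnonneg
  rw [hn] at hne hcolon hleast
  have hstab : stabilityIndex I = n + 1 := by
    refine stabilityIndex_eq ha (fun t ht => ?_) fun heq => hne ?_
    · refine (eq_of_le_of_colength_eq (hI t) (pow_le_colon_singleton ha t) ?_).symm
      have h := (hleast.1 t (by lia)).symm.trans (hcolon t (by lia)).symm
      exact_mod_cast h
    · rw [← hcolon n le_rfl]
      exact congrArg (fun K => (colength K : ℚ)) heq
  rw [hn, hstab]
  push_cast
  ring

theorem IsSuperficialReduction.isMinimalReduction [IsLocalRing R] [Infinite (ResidueField R)]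
    (hR : IsCohenMacaulayLocal R) (hdim : ringKrullDim R = 2)
    (hI : I.radical = maximalIdeal R) (hab : IsSuperficialReduction I a b) :
    IsMinimalReduction I (Ideal.span {a, b}) := by
  have := hR.noetherian
  refine ⟨hab.isReduction, fun K hK hKab => ?_⟩
  obtain ⟨a', ha', b', hb', hab'⟩ := hK.exists_isSuperficialReduction hR hdim hI
  have hle : Ideal.span {a', b'} ≤ K := Ideal.span_le.2 (Set.pair_subset ha' hb')
  have hfin : IsFiniteLength R (R ⧸ Ideal.span {a', b'}) :=
    isFiniteLength_quotient_of_maximalIdeal_le_radical (hab'.isReduction.radical_eq ▸ hI.ge)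
  have heq := eq_of_le_of_colength_eq hfin (hle.trans hKab) (hab'.colength_span_pair_eq
    (isFiniteLength_quotient_pow hI.ge) hab)
  exact heq ▸ hle

theorem exists_isSuperficialReduction_mul_pow_reductionNumber [IsLocalRing R]
    [Infinite (ResidueField R)] (hR : IsCohenMacaulayLocal R) (hdim : ringKrullDim R = 2)
    (hI : I.radical = maximalIdeal R) :
    ∃ a b, IsSuperficialReduction I a b ∧
      Ideal.span {a, b} * I ^ reductionNumber I = I ^ (reductionNumber I + 1) := by
  have hrefl : IsReduction I I := ⟨le_rfl, 0, (pow_succ' I 0).symm⟩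
  obtain ⟨a₀, -, b₀, -, hab₀⟩ := hrefl.exists_isSuperficialReduction hR hdim hI
  obtain ⟨J, hJ, hJr⟩ : reductionNumber I ∈
      {r | ∃ J, IsMinimalReduction I J ∧ reductionNumberWrt I J = r} :=
    Nat.sInf_mem ⟨_, _, hab₀.isMinimalReduction hR hdim hI, rfl⟩
  obtain ⟨a, ha, b, hb, hab⟩ := hJ.1.exists_isSuperficialReduction hR hdim hI
  have hle : Ideal.span {a, b} ≤ J := Ideal.span_le.2 (Set.pair_subset ha hb)
  refine ⟨a, b, hab, ?_⟩
  rw [hle.antisymm (hJ.2 hab.isReduction hle), ← hJr]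
  exact Nat.sInf_mem (s := {n | J * I ^ n = I ^ (n + 1)}) hJ.1.2

end ReductionNumber

end RatliffRush

theorem theorem3p4 {R : Type*} [CommRing R] [IsLocalRing R]
    [Infinite (IsLocalRing.ResidueField R)]
    (hR : RatliffRush.IsCohenMacaulayLocal R) (hdim : ringKrullDim R = 2)
    (I : Ideal R) (hI : RatliffRush.IsMaxPrimary I)
    (x : R) (hx : RatliffRush.IsSuperficial I x)
    (h : RatliffRush.postulationNumber I ≠ (RatliffRush.stabilityIndex I : ℤ) - 1) :
    RatliffRush.postulationNumber I + 2 ≤ (RatliffRush.reductionNumber I : ℤ) := by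
  have := hR.noetherian
  obtain ⟨a, b, hab, hr⟩ :=
    RatliffRush.exists_isSuperficialReduction_mul_pow_reductionNumber hR hdim hI.2
  by_contra! hlt
  exact h <| hab.postulationNumber_eq (RatliffRush.isFiniteLength_quotient_pow hI.2.ge)
    hI.1.ne_top hr (by lia)
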